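/- All rings are associative with unit, and modules are left modules unless stated otherwise. **Definitions.** A ring epimorphism is an epimorphism in the category of unital rings. Two ring epimorphisms $f:A\to B$ and $g:A\to C$ are equivalent ("$B$ and $C$ lie in the same epiclass of $A$") if there is a ring isomorphism $h:B\to C$ with $g=hf$. A ring epimorphism $f:A\to B$ is *homological* if $\mathrm{Tor}_i^A(B,B)=0$ for all $i>0$, and *1-finite* if $f$ turns $B$ into a finitely presented left $A$-module of projective dimension at most $1$. For a set $\Sigma$ of maps between finitely generated projective left $A$-modules, the universal localisation $f_\Sigma:A\to A_\Sigma$ is the ring homomorphism such that $A_\Sigma\otimes_A\sigma$ is an isomorphism for all $\sigma\in\Sigma$ and such that every ring homomorphism $g:A\to C$ for which $C\otimes_A\sigma$ is an isomorphism for all $\sigma\in\Sigma$ factors uniquely through $f_\Sigma$. For a finitely presented left $A$-module $U$ of projective dimension at most $1$, $A_{\{U\}}$ denotes $A_{\{\sigma_U\}}$, where $0\to P\xrightarrow{\sigma_U}Q\to U\to 0$ is any exact sequence with $P,Q$ finitely generated projective. **Statement.** Let $f:A\to B$ be a homological 1-finite ring epimorphism. 1. If $f$ is injective, then $\mathrm{coker}(f)=B/A$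 is a finitely presented left $A$-module of projective dimension at most $1$, and $B$ and $A_{\{B/A\}}$ lie in the same epiclass of $A$. 2. If $f$ is surjective, then $\ker(f)$ is a finitely presented projective left $A$-module, and $B$ and $A_{\{\ker(f)\}}$ lie in the same epiclass of $A$. 3. If $A$ is a finite dimensional algebra over a field $\mathbb{K}$ and $f$ is surjective, then there is an idempotent $e\in A$ such that $B$ and $A/AeA$ lie in the same epiclass of $A$. -/

import Mathlib

open CategoryTheory
open scoped TensorProduct

universe u v w

noncomputable section

namespace RingEpi

/-! ### Extension of scalars along a homomorphism of (non-commutative) rings -/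

section Extension

variable {A : Type u} {C : Type w} [Ring A] [Ring C] (f : A →+* C)

/-- The relations `c f(a) ⊗ m = c ⊗ a m` of the balanced tensor product `C ⊗_A M`. The set of
relators is stable under left multiplication by `C`, so that the `C`-submodule spanned by it is the
subgroup generated by it. -/
def balancedRel (M : Type v) [AddCommGroup M] [Module A M] : Submodule C (C ⊗[ℤ] M) :=
  Submodule.span C {x | ∃ (c : C) (a : A) (m : M), x = (c * f a) ⊗ₜ[ℤ] m - c ⊗ₜ[ℤ] (a • m)}

/-- The left `C`-module `C ⊗_A M`, where `C` is a right `A`-module through `f : A → C` and `M` is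
a left `A`-module. -/
abbrev ExtScalars (M : Type v) [AddCommGroup M] [Module A M] : Type (max w v) :=
  (C ⊗[ℤ] M) ⧸ balancedRel f M

variable {M N L : Type v} [AddCommGroup M] [Module A M] [AddCommGroup N] [Module A N]
  [AddCommGroup L] [Module A L]

/-- The element `c ⊗ m` of `C ⊗_A M`. -/
def ExtScalars.tmul (c : C) (m : M) : ExtScalars f M := Submodule.Quotient.mk (c ⊗ₜ[ℤ] m)

/-- The map `C ⊗_ℤ g : C ⊗_ℤ M → C ⊗_ℤ N` as a homomorphism of left `C`-modules. -/
def preMap (g : M →ₗ[A] N) : (C ⊗[ℤ] M) →ₗ[C] (C ⊗[ℤ] N) :=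
  TensorProduct.AlgebraTensorModule.map (LinearMap.id : C →ₗ[C] C) g.toAddMonoidHom.toIntLinearMap

theorem preMap_tmul (g : M →ₗ[A] N) (c : C) (m : M) :
    preMap g (c ⊗ₜ[ℤ] m) = c ⊗ₜ[ℤ] g m := rfl

theorem balancedRel_le (g : M →ₗ[A] N) :
    balancedRel f M ≤ (balancedRel f N).comap (preMap g) := by
  refine Submodule.span_le.2 ?_
  rintro _ ⟨c, a, m, rfl⟩
  refine Submodule.subset_span ⟨c, a, g m, ?_⟩
  rw [map_sub, preMap_tmul, preMap_tmul, map_smul]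

/-- The homomorphism `C ⊗_A g : C ⊗_A M → C ⊗_A N` of left `C`-modules. -/
def ExtScalars.map (g : M →ₗ[A] N) : ExtScalars f M →ₗ[C] ExtScalars f N :=
  (balancedRel f M).mapQ (balancedRel f N) (preMap g) (balancedRel_le f g)

theorem ExtScalars.map_tmul (g : M →ₗ[A] N) (c : C) (m : M) :
    ExtScalars.map f g (ExtScalars.tmul f c m) = ExtScalars.tmul f c (g m) := rfl

variable {f} in
theorem ExtScalars.hom_ext {X : Type*} [AddCommGroup X] [Module C X] {g h : ExtScalars f M →ₗ[C] X}
    (H : ∀ c m, g (ExtScalars.tmul f c m) = h (ExtScalars.tmul f c m)) : g = h := by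
  refine Submodule.linearMap_qext _ (LinearMap.toAddMonoidHom_injective ?_)
  ext x
  induction x using TensorProduct.induction_on with
  | zero => simp
  | tmul c m => exact H c m
  | add x y hx hy => rw [map_add, map_add, hx, hy]

theorem ExtScalars.tmul_add (c : C) (m n : M) :
    ExtScalars.tmul f c (m + n) = ExtScalars.tmul f c m + ExtScalars.tmul f c n :=
  congrArg Submodule.Quotient.mk (TensorProduct.tmul_add c m n)

end Extension

/-- The functor `C ⊗_A -` from left `A`-modules to left `C`-modules. -/
def extFunctor {A : Type u} {C : Type w} [Ring A] [Ring C] (f : A →+* C) :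
    ModuleCat.{v} A ⥤ ModuleCat.{max w v} C where
  obj M := ModuleCat.of C (ExtScalars f M)
  map g := ModuleCat.ofHom (ExtScalars.map f g.hom)
  map_id _ := ModuleCat.hom_ext (ExtScalars.hom_ext fun _ _ => rfl)
  map_comp _ _ := ModuleCat.hom_ext (ExtScalars.hom_ext fun _ _ => rfl)

instance {A : Type u} {C : Type w} [Ring A] [Ring C] (f : A →+* C) :
    (extFunctor.{u, v, w} f).Additive where
  map_add {_ _ g h} := ModuleCat.hom_ext (ExtScalars.hom_ext fun c m => ExtScalars.tmul_add f c (g.hom m) (h.hom m))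

section Epi

variable {A B C : Type u} [Ring A] [Ring B] [Ring C]

/-- `Tor_i^A(B, M)` for a ring homomorphism `f : A → B` and a left `A`-module `M`: the `i`-th left
derived functor of `B ⊗_A -`, applied to `M`. -/
def Tor (f : A →+* B) (i : ℕ) (M : ModuleCat.{u} A) : ModuleCat.{u} B :=
  ((extFunctor.{u, u, u} f).leftDerived i).obj M

/-- `B` as a left `A`-module through `f : A → B`. -/
def asModule (f : A →+* B) : ModuleCat.{u} A :=
  (ModuleCat.restrictScalars f).obj (ModuleCat.of B B)

/-- `f : A → B` as a homomorphism of left `A`-modules. -/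
def asLinearMap (f : A →+* B) : A →ₗ[A] asModule f where
  toFun a := (f a : B)
  map_add' := f.map_add
  map_smul' := f.map_mul

/-- The left `A`-module `coker f = B / f(A)`. -/
abbrev coker (f : A →+* B) : ModuleCat.{u} A :=
  ModuleCat.of A (asModule f ⧸ LinearMap.range (asLinearMap f))

/-- The left `A`-module `ker f`. -/
abbrev ker (f : A →+* B) : ModuleCat.{u} A := ModuleCat.of A (RingHom.ker f)

/-- Ring epimorphisms: epimorphisms in the category of rings with unit. -/
def IsRingEpi (f : A →+* B) : Prop := Epi (RingCat.ofHom f)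

/-- A ring epimorphism `f : A → B` is homological if `Tor_i^A(B, B) = 0` for all `i > 0`. -/
def IsHomological (f : A →+* B) : Prop :=
  IsRingEpi f ∧ ∀ i : ℕ, 0 < i → Limits.IsZero (Tor f i (asModule f))

/-- Finitely presented left modules of projective dimension at most one. -/
def IsFPOfProjDimLEOne (M : ModuleCat.{u} A) : Prop :=
  Module.FinitePresentation A M ∧ HasProjectiveDimensionLE M 1

/-- A ring epimorphism `f : A → B` is 1-finite if `B` is a finitely presented left `A`-module of
projective dimension at most one. -/
def IsOneFinite (f : A →+* B) : Prop :=
  IsRingEpi f ∧ IsFPOfProjDimLEOne (asModule f)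

/-- `f : A → B` and `g : A → C` are equivalent, i.e. `B` and `C` lie in the same epiclass of `A`:
both are ring epimorphisms and there is a ring isomorphism `h : B → C` with `g = h f`. -/
def SameEpiclass (f : A →+* B) (g : A →+* C) : Prop :=
  IsRingEpi f ∧ IsRingEpi g ∧ ∃ h : B ≃+* C, g = (h : B →+* C).comp f

end Epi

/-! ### Universal localisations -/

/-- A homomorphism between finitely generated projective left `A`-modules. -/
structure ProjMap (A : Type u) [Ring A] where
  P : ModuleCat.{u} A
  Q : ModuleCat.{u} A
  finite_P : Module.Finite A P
  finite_Q : Module.Finite A Q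
  projective_P : Module.Projective A P
  projective_Q : Module.Projective A Q
  hom : P →ₗ[A] Q

/-- `σ : P → Q` is a projective resolution of `U`: there is a short exact sequence
`0 → P → Q → U → 0` of left `A`-modules whose first map is `σ`. -/
def ProjMap.Resolves {A : Type u} [Ring A] (σ : ProjMap A) (U : ModuleCat.{u} A) : Prop :=
  Function.Injective σ.hom ∧
    ∃ p : σ.Q →ₗ[A] U, Function.Exact σ.hom p ∧ Function.Surjective p

/-- `f` inverts `Σ`: the map `C ⊗_A σ` is an isomorphism for all `σ ∈ Σ`. -/
def Inverts {A : Type u} {C : Type w} [Ring A] [Ring C] (f : A →+* C) (S : Set (ProjMap A)) :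
    Prop :=
  ∀ σ ∈ S, Function.Bijective (ExtScalars.map f σ.hom)

/-- `f : A → B` is the universal localisation of `A` at `Σ` (a set of maps between finitely
generated projective modules): `f` inverts `Σ`, and every ring homomorphism `g : A → C` that
inverts `Σ` factors in a unique way through `f`. The universe `w` of the test rings is arbitrary. -/
def IsUniversalLocalisation {A B : Type u} [Ring A] [Ring B] (f : A →+* B)
    (S : Set (ProjMap A)) : Prop :=
  Inverts f S ∧
    ∀ (C : Type w) [Ring C] (g : A →+* C), Inverts g S → ∃! h : B →+* C, g = h.comp f

/-- `f : A → B` is the universal localisation of `A` at a set `𝓤` of finitely presented left modules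
of projective dimension at most one: each `U ∈ 𝓤` has a projective resolution `σ_U : P → Q` with
`P`, `Q` finitely generated, and for each choice of such resolutions, `f` is the universal
localisation of `A` at `{σ_U | U ∈ 𝓤}`. -/
def IsUniversalLocalisationAt {A B : Type u} [Ring A] [Ring B] (f : A →+* B)
    (𝓤 : Set (ModuleCat.{u} A)) : Prop :=
  (∀ U ∈ 𝓤, IsFPOfProjDimLEOne U ∧ ∃ σ : ProjMap A, σ.Resolves U) ∧
    ∀ s : 𝓤 → ProjMap A, (∀ U : 𝓤, (s U).Resolves U) →
      IsUniversalLocalisation.{u, w} f (Set.range s)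

/-- `B` lies in the same epiclass of `A` as the universal localisation `A_𝓤`. -/
def SameEpiclassAsLocalisationAt {A B : Type u} [Ring A] [Ring B] (f : A →+* B)
    (𝓤 : Set (ModuleCat.{u} A)) : Prop :=
  ∃ (L : Type u) (_ : Ring L) (ι : A →+* L),
    IsUniversalLocalisationAt.{u, w} ι 𝓤 ∧ SameEpiclass f ι

/-- The canonical surjection `A → A / AeA`, where `AeA` is the two-sided ideal generated by `e`. -/
def modIdeal {A : Type u} [Ring A] (e : A) :
    A →+* (TwoSidedIdeal.span ({e} : Set A)).ringCon.Quotient :=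
  (TwoSidedIdeal.span ({e} : Set A)).ringCon.mk'

end RingEpi

end

/-!
Let `σ : P → Q` resolve the kernel or the cokernel `U` of `f`, and let `C ⊗ -` denote extension of
scalars along `g : A → C`.

If `f` is injective, pulling `A → B → U` back along `Q → U` yields a resolution
`0 → P → Q × A → B → 0`. Since `Tor₁(B, B) = 0` and `B → B ⊗ B` is bijective, `B ⊗ σ` is bijective.
Conversely, `B` is the pushout of `σ` along `P → A`, so when `C ⊗ σ` is bijective `g` has a unique
`g`-semilinear extension to `B`; applied to right translates, uniqueness makes it multiplicative.

If `f` is surjective, then `U = ker f` is projective and `Tor₁(B, B) = 0` amounts to `B ⊗ U = 0`, so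
`B ⊗ σ` is bijective. If `C ⊗ σ` is bijective then `C ⊗ U = 0`, so `g` vanishes on `U` and factors
through `f`. Moreover a dual basis of `U` has coordinates in `U`, because `B ⊗ U = 0`; hence `U` is
an idempotent ideal, and a finitely generated idempotent two-sided ideal of a semiperfect ring is
generated by an idempotent, by lifting one modulo the radical and applying Nakayama's lemma.
-/

noncomputable section

namespace RingEpi

theorem exists_semilinear_factor {A : Type*} {C : Type*} [Ring A] [Ring C] {f : A →+* C}
    {M N X : Type*} [AddCommGroup M] [Module A M] [AddCommGroup N] [Module A N] [AddCommGroup X]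
    [Module C X] {p : M →ₗ[A] N} (hp : Function.Surjective p) (ψ : M →ₛₗ[f] X)
    (h : ∀ x, p x = 0 → ψ x = 0) : ∃ φ : N →ₛₗ[f] X, ∀ x, φ (p x) = ψ x := by
  have hψ : p.ker ≤ ψ.ker := h
  refine ⟨(p.ker.liftQ ψ hψ).comp (p.quotKerEquivOfSurjective hp).symm.toLinearMap, fun x => ?_⟩
  have hx : (p.quotKerEquivOfSurjective hp).symm (p x) = Submodule.Quotient.mk x :=
    (LinearEquiv.symm_apply_eq _).2 rfl
  exact congrArg (p.ker.liftQ ψ hψ) hx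

namespace ExtScalars

section UniversalProperty

variable {A : Type u} {C : Type w} [Ring A] [Ring C] (f : A →+* C)
variable {M N L : Type v} [AddCommGroup M] [Module A M] [AddCommGroup N] [Module A N]
  [AddCommGroup L] [Module A L] {X : Type*} [AddCommGroup X] [Module C X]

/-- The universal semilinear map `m ↦ 1 ⊗ m` from `M` to `C ⊗_A M`. -/
def unit : M →ₛₗ[f] ExtScalars f M where
  toFun := tmul f 1
  map_add' := tmul_add f 1
  map_smul' a m := by
    have h : tmul f (1 * f a) m = tmul f 1 (a • m) :=
      (Submodule.Quotient.eq _).2 (Submodule.subset_span ⟨1, a, m, rfl⟩)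
    rw [← h]
    exact congrArg (tmul f · m) ((one_mul (f a)).trans (mul_one (f a)).symm)

theorem smul_unit (c : C) (m : M) : c • unit f m = tmul f c m :=
  congrArg (tmul f · m) (mul_one c)

theorem map_unit (g : M →ₗ[A] N) (m : M) : map f g (unit f m) = unit f (g m) := rfl

variable {f}

theorem hom_ext_unit {g h : ExtScalars f M →ₗ[C] X} (H : ∀ m, g (unit f m) = h (unit f m)) :
    g = h :=
  hom_ext fun c m => by rw [← smul_unit, map_smul, map_smul, H]

/-- The `C`-linear map `C ⊗_A M → X` corresponding to a semilinear map `M → X`. -/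
def lift (φ : M →ₛₗ[f] X) : ExtScalars f M →ₗ[C] X :=
  (balancedRel f M).liftQ
    (TensorProduct.AlgebraTensorModule.lift
      (LinearMap.toSpanSingleton C (M →ₗ[ℤ] X) φ.toAddMonoidHom.toIntLinearMap)) <| by
    refine Submodule.span_le.2 ?_
    rintro _ ⟨c, a, m, rfl⟩
    simp [mul_smul]

theorem lift_unit (φ : M →ₛₗ[f] X) (m : M) : lift φ (unit f m) = φ m :=
  one_smul C (φ m)

theorem eq_top_of_unit_mem {S : Submodule C (ExtScalars f M)} (hS : ∀ m, unit f m ∈ S) :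
    S = ⊤ := by
  have h : S.mkQ = 0 := hom_ext_unit fun m => (Submodule.Quotient.mk_eq_zero S).2 (hS m)
  rw [← S.ker_mkQ, h, LinearMap.ker_zero]

theorem semilinear_eq_zero [Subsingleton (ExtScalars f M)] (φ : M →ₛₗ[f] X) : φ = 0 :=
  LinearMap.ext fun m => by
    rw [← lift_unit φ, Subsingleton.elim (unit f m) 0, map_zero, LinearMap.zero_apply]

theorem map_comp_apply (h : N →ₗ[A] L) (g : M →ₗ[A] N) (z : ExtScalars f M) :
    map f (h ∘ₗ g) z = map f h (map f g z) :=
  LinearMap.congr_fun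
    (hom_ext_unit (g := map f (h ∘ₗ g)) (h := map f h ∘ₗ map f g) fun _ => rfl) z

theorem map_eq_zero {g : M →ₗ[A] N} (hg : ∀ m, unit f (g m) = 0) : map f g = 0 :=
  hom_ext_unit hg

theorem map_injective_of_comp_eq_id {g : M →ₗ[A] N} {r : N →ₗ[A] M}
    (h : r ∘ₗ g = LinearMap.id) : Function.Injective (map f g) := by
  have hid : map f r ∘ₗ map f g = LinearMap.id :=
    hom_ext_unit fun m => congrArg (unit f) (LinearMap.congr_fun h m)
  exact Function.LeftInverse.injective (LinearMap.congr_fun hid)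

theorem map_prod_apply (g : M →ₗ[A] N) (h : M →ₗ[A] L) (z : ExtScalars f M) :
    map f (g.prod h) z =
      map f (LinearMap.inl A N L) (map f g z) + map f (LinearMap.inr A N L) (map f h z) :=
  LinearMap.congr_fun (hom_ext_unit
    (h := map f (LinearMap.inl A N L) ∘ₗ map f g + map f (LinearMap.inr A N L) ∘ₗ map f h)
    fun m => by
      rw [LinearMap.add_apply, LinearMap.comp_apply, LinearMap.comp_apply]
      simp only [map_unit, ← map_add]
      simp) z

end UniversalProperty

section Exact

variable {A : Type u} {C : Type w} [Ring A] [Ring C] {f : A →+* C}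
variable {M N L : Type v} [AddCommGroup M] [Module A M] [AddCommGroup N] [Module A N]
  [AddCommGroup L] [Module A L] {X : Type*} [AddCommGroup X] [Module C X]

theorem semilinear_ext_of_exact {σ : M →ₗ[A] N} {p : N →ₗ[A] L} (he : Function.Exact σ p)
    (hp : Function.Surjective p) [Subsingleton (ExtScalars f L)] {φ ψ : N →ₛₗ[f] X}
    (H : ∀ m, φ (σ m) = ψ (σ m)) : φ = ψ := by
  obtain ⟨χ, hχ⟩ := exists_semilinear_factor hp (φ - ψ) fun x hx => by
    obtain ⟨m, rfl⟩ := (he x).1 hx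
    exact sub_eq_zero.2 (H m)
  refine LinearMap.ext fun x => sub_eq_zero.1 ?_
  rw [← LinearMap.sub_apply, ← hχ, semilinear_eq_zero χ, LinearMap.zero_apply]

theorem map_surjective_iff_subsingleton {σ : M →ₗ[A] N} {p : N →ₗ[A] L}
    (he : Function.Exact σ p) (hp : Function.Surjective p) :
    Function.Surjective (map f σ) ↔ Subsingleton (ExtScalars f L) := by
  constructor
  · intro hσ
    have hpσ : ∀ z, map f p (map f σ z) = 0 := fun z => by
      rw [← map_comp_apply, he.linearMap_comp_eq_zero, map_eq_zero fun _ => map_zero (unit f),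
        LinearMap.zero_apply]
    have hbot : (⊥ : Submodule C (ExtScalars f L)) = ⊤ := eq_top_of_unit_mem fun l => by
      obtain ⟨x, rfl⟩ := hp l
      obtain ⟨z, hz⟩ := hσ (unit f x)
      rw [← map_unit, ← hz, hpσ]
      exact Submodule.zero_mem _
    exact (Submodule.subsingleton_iff C).1 (subsingleton_of_bot_eq_top hbot)
  · intro _
    let R := LinearMap.range (map f σ)
    have h : R.mkQ.comp (unit f) = (0 : N →ₛₗ[f] _) := semilinear_ext_of_exact he hp fun m =>
      (Submodule.Quotient.mk_eq_zero R).2 ⟨unit f m, map_unit f σ m⟩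
    exact LinearMap.range_eq_top.1 (eq_top_of_unit_mem fun x =>
      (Submodule.Quotient.mk_eq_zero R).1 (LinearMap.congr_fun h x))

theorem exists_semilinear_extension_of_bijective {σ : M →ₗ[A] N}
    (hσ : Function.Bijective (map f σ)) (ψ : M →ₛₗ[f] X) :
    ∃ θ : N →ₛₗ[f] X, ∀ m, θ (σ m) = ψ m := by
  let e := LinearEquiv.ofBijective (map f σ) hσ
  refine ⟨(lift ψ ∘ₗ e.symm.toLinearMap).comp (unit f), fun m => ?_⟩
  have hm : e.symm (unit f (σ m)) = unit f m := (LinearEquiv.symm_apply_eq e).2 rfl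
  exact (congrArg (lift ψ) hm).trans (lift_unit ψ m)

end Exact

end ExtScalars

section Epimorphisms

variable {A B : Type u} [Ring A] [Ring B] {f : A →+* B}

theorem isRingEpi_of_surjective (hf : Function.Surjective f) : IsRingEpi f :=
  ConcreteCategory.epi_of_surjective (RingCat.ofHom f) hf

theorem IsRingEpi.eq_of_comp_eq {C : Type u} [Ring C] (hf : IsRingEpi f) {g h : B →+* C}
    (H : g.comp f = h.comp f) : g = h := by
  have : Epi (RingCat.ofHom f) := hf
  have hgh : RingCat.ofHom f ≫ RingCat.ofHom g = RingCat.ofHom f ≫ RingCat.ofHom h :=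
    RingCat.hom_ext H
  exact congrArg RingCat.Hom.hom ((cancel_epi _).1 hgh)

/-- The two actions of `B` on `M × N` compared in the proof are the given one and its conjugate by
the shear `(m, n) ↦ (m, n + φ m)`; they agree on `A` because `φ` is `A`-linear. -/
theorem IsRingEpi.map_smul_of_map_smul (hf : IsRingEpi f) {M N : Type u} [AddCommGroup M]
    [Module B M] [AddCommGroup N] [Module B N] (φ : M →+ N)
    (hφ : ∀ (a : A) (m : M), φ (f a • m) = f a • φ m) (b : B) (m : M) :
    φ (b • m) = b • φ m := by
  let shear : (M × N) ≃ₗ[ℤ] (M × N) :=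
    (LinearEquiv.refl ℤ M).skewProd (LinearEquiv.refl ℤ N) φ.toIntLinearMap
  let ρ : B →+* Module.End ℤ (M × N) := Module.toModuleEnd ℤ (S := B) (M × N)
  let ρ' : B →+* Module.End ℤ (M × N) := (shear.conjRingEquiv : _ →+* _).comp ρ
  have hρ' (b : B) (x : M × N) : ρ' b (shear x) = shear (b • x) :=
    congrArg (fun y => shear (b • y)) (shear.symm_apply_apply x)
  have hρ : ρ' = ρ := hf.eq_of_comp_eq <| RingHom.ext fun a => LinearMap.ext fun y => by
    obtain ⟨x, rfl⟩ := shear.surjective y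
    refine (hρ' (f a) x).trans (Prod.ext rfl ?_)
    change f a • x.2 + φ (f a • x.1) = f a • (x.2 + φ x.1)
    rw [hφ, smul_add]
  have h : shear (b • (m, 0)) = b • shear (m, 0) :=
    (hρ' b (m, 0)).symm.trans (LinearMap.congr_fun (RingHom.congr_fun hρ b) _)
  simpa [shear] using congrArg Prod.snd h

variable (f) in
/-- The underlying additive equivalence between `B` and `asModule f`, to tell elements of the ring
from elements of the module. -/
def toAsModule : B ≃+ asModule f := AddEquiv.refl B

theorem asLinearMap_apply (a : A) : asLinearMap f a = toAsModule f (f a) := rfl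

theorem IsRingEpi.unit_toAsModule_mul (hf : IsRingEpi f) (b x : B) :
    ExtScalars.unit f (toAsModule f (b * x)) = b • ExtScalars.unit f (toAsModule f x) :=
  hf.map_smul_of_map_smul
    ((ExtScalars.unit f).toAddMonoidHom.comp (toAsModule f).toAddMonoidHom)
    (fun a y => (ExtScalars.unit f).map_smulₛₗ a (toAsModule f y)) b x

theorem IsRingEpi.map_asLinearMap_bijective (hf : IsRingEpi f) :
    Function.Bijective (ExtScalars.map f (asLinearMap f)) := by
  let μ : asModule f →ₛₗ[f] B :=
    { toFun := (toAsModule f).symm, map_add' := map_add _, map_smul' := fun _ _ => rfl }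
  let η : B →ₗ[B] ExtScalars f A := LinearMap.toSpanSingleton B _ (ExtScalars.unit f 1)
  have hη : η ∘ₗ ExtScalars.lift μ ∘ₗ ExtScalars.map f (asLinearMap f) = LinearMap.id :=
    ExtScalars.hom_ext_unit fun a => by
      change ExtScalars.lift μ (ExtScalars.unit f (toAsModule f (f a))) • ExtScalars.unit f 1 = _
      rw [ExtScalars.lift_unit]
      change f a • ExtScalars.unit f 1 = ExtScalars.unit f a
      rw [← LinearMap.map_smulₛₗ, smul_eq_mul, mul_one]
  refine ⟨Function.LeftInverse.injective (g := η ∘ₗ ExtScalars.lift μ) (LinearMap.congr_fun hη),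
    LinearMap.range_eq_top.1 (ExtScalars.eq_top_of_unit_mem fun x => ?_)⟩
  obtain ⟨b, rfl⟩ := (toAsModule f).surjective x
  refine ⟨b • ExtScalars.unit f 1, ?_⟩
  rw [map_smul, ExtScalars.map_unit, asLinearMap_apply, map_one, ← hf.unit_toAsModule_mul, mul_one]

/-- The test ring `C` may live in any universe, unlike in the definition of `IsRingEpi`. -/
theorem IsRingEpi.ringHom_ext (hf : IsRingEpi f) {C : Type w} [Ring C] {g h : B →+* C}
    (H : g.comp f = h.comp f) : g = h := by
  let _ : Module B C := Module.compHom C g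
  let φ : asModule f →ₛₗ[f] C :=
    { toFun := fun x => h ((toAsModule f).symm x)
      map_add' := fun x y => map_add h _ _
      map_smul' := fun a x =>
        (map_mul h (f a) _).trans (congrArg (· * h _) (RingHom.congr_fun H a).symm) }
  ext b
  have hb : h (b * 1) = g b * h 1 := by
    have := congrArg (ExtScalars.lift φ) (hf.unit_toAsModule_mul b 1)
    rwa [map_smul, ExtScalars.lift_unit, ExtScalars.lift_unit] at this
  rw [← mul_one (g b), ← map_one h, ← hb, mul_one]

end Epimorphisms

section TwoTermResolution

variable {𝒜 : Type*} [Category* 𝒜] [Abelian 𝒜] {S : ShortComplex 𝒜}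

/-- The chain complex `⋯ → 0 → X₁ → X₂`, with `X₂` in degree `0`, of a short complex
`X₁ → X₂ → X₃`. -/
def twoTerm (S : ShortComplex 𝒜) : ChainComplex 𝒜 ℕ :=
  .double S.f (c := .down ℕ) (show (ComplexShape.down ℕ).Rel 1 0 from rfl)

/-- The identification of the term of degree `1` of `twoTerm S`. -/
def twoTermXIso₁ (S : ShortComplex 𝒜) : (twoTerm S).X 1 ≅ S.X₁ :=
  HomologicalComplex.doubleXIso₀ S.f (show (ComplexShape.down ℕ).Rel 1 0 from rfl)

/-- The identification of the term of degree `0` of `twoTerm S`. -/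
def twoTermXIso₀ (S : ShortComplex 𝒜) : (twoTerm S).X 0 ≅ S.X₂ :=
  HomologicalComplex.doubleXIso₁ S.f (show (ComplexShape.down ℕ).Rel 1 0 from rfl) one_ne_zero

theorem twoTerm_d (S : ShortComplex 𝒜) :
    (twoTerm S).d 1 0 = (twoTermXIso₁ S).hom ≫ S.f ≫ (twoTermXIso₀ S).inv :=
  HomologicalComplex.double_d _ _ one_ne_zero

theorem isZero_twoTerm_X (S : ShortComplex 𝒜) (n : ℕ) : Limits.IsZero ((twoTerm S).X (n + 2)) :=
  HomologicalComplex.isZero_double_X _ _ _ (by lia) (by lia)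

theorem twoTerm_exactAt_succ [Mono S.f] (n : ℕ) : (twoTerm S).ExactAt (n + 1) := by
  rw [HomologicalComplex.exactAt_iff' _ (n + 2) (n + 1) n (by simp) (by simp)]
  cases n with
  | zero =>
    refine (ShortComplex.exact_iff_mono _ ((isZero_twoTerm_X S 0).eq_of_src _ _)).2 ?_
    change Mono ((twoTerm S).d 1 0)
    rw [twoTerm_d]
    infer_instance
  | succ n => exact ShortComplex.exact_of_isZero_X₂ _ (isZero_twoTerm_X S n)

/-- The projective resolution of `X₃` given by a short exact sequence `0 → X₁ → X₂ → X₃ → 0` with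
`X₁` and `X₂` projective. -/
def twoTermResolution (hS : S.ShortExact) [Projective S.X₁] [Projective S.X₂] :
    ProjectiveResolution S.X₃ where
  complex := twoTerm S
  projective
    | 0 => Projective.of_iso (twoTermXIso₀ S).symm inferInstance
    | 1 => Projective.of_iso (twoTermXIso₁ S).symm inferInstance
    | n + 2 => (isZero_twoTerm_X S n).projective
  π := (ChainComplex.toSingle₀Equiv _ _).symm ⟨(twoTermXIso₀ S).hom ≫ S.g, by simp [twoTerm_d]⟩
  quasiIso := ⟨fun n => by
    have := hS.mono_f
    cases n with
    | zero =>
      have hd : (twoTermXIso₁ S).hom ≫ S.f = (twoTerm S).d 1 0 ≫ (twoTermXIso₀ S).hom := by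
        simp [twoTerm_d]
      rw [ChainComplex.quasiIsoAt₀_iff, ShortComplex.quasiIso_iff_of_zeros' _
        ((twoTerm S).shape 0 0 (by simp)) rfl rfl]
      refine (ShortComplex.exact_and_epi_g_iff_of_iso ?_).2 ⟨hS.exact, hS.epi_g⟩
      exact ShortComplex.isoMk (twoTermXIso₁ S) (twoTermXIso₀ S) (Iso.refl _) hd <|
        Eq.symm ((Category.comp_id _).trans
          (ChainComplex.toSingle₀Equiv_symm_apply_f_zero (C := twoTerm S) _ _))
    | succ n =>
      rw [quasiIsoAt_iff_exactAt']
      · exact twoTerm_exactAt_succ n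
      · exact ChainComplex.exactAt_succ_single_obj _ _⟩

theorem mono_map_of_isZero_leftDerived_one {ℬ : Type*} [Category* ℬ] [Abelian ℬ]
    [HasProjectiveResolutions 𝒜] (F : 𝒜 ⥤ ℬ) [F.Additive] (hS : S.ShortExact) [Projective S.X₁]
    [Projective S.X₂] (hF : Limits.IsZero ((F.leftDerived 1).obj S.X₃)) : Mono (F.map S.f) := by
  have hexact : ((F.mapHomologicalComplex _).obj (twoTerm S)).ExactAt 1 :=
    (HomologicalComplex.exactAt_iff_isZero_homology _ _).2
      (hF.of_iso ((twoTermResolution hS).isoLeftDerivedObj F 1).symm)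
  rw [HomologicalComplex.exactAt_iff' _ 2 1 0 (by simp) (by simp)] at hexact
  have hd : Mono (F.map ((twoTerm S).d 1 0)) := (ShortComplex.exact_iff_mono _
    ((F.map_isZero (isZero_twoTerm_X S 0)).eq_of_src _ _)).1 hexact
  have h : F.map S.f =
      F.map (twoTermXIso₁ S).inv ≫ F.map ((twoTerm S).d 1 0) ≫ F.map (twoTermXIso₀ S).hom := by
    simp [twoTerm_d]
  rw [h]
  infer_instance

end TwoTermResolution

section ProjectiveDimension

variable {A B : Type u} [Ring A] [Ring B] {f : A →+* B}
variable {P Q : Type u} [AddCommGroup P] [Module A P] [AddCommGroup Q] [Module A Q]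
  {U : ModuleCat.{u} A} {σ : P →ₗ[A] Q} {p : Q →ₗ[A] U}

theorem shortExact_shortComplexOfCompEqZero (hσ : Function.Injective σ) (he : Function.Exact σ p)
    (hp : Function.Surjective p) :
    (ModuleCat.shortComplexOfCompEqZero σ p he.linearMap_comp_eq_zero).ShortExact :=
  ModuleCat.shortComplex_shortExact _ he hσ hp

theorem map_injective_of_isZero_tor (hU : Limits.IsZero (Tor f 1 U)) [Module.Projective A P]
    [Module.Projective A Q] (hσ : Function.Injective σ) (he : Function.Exact σ p)
    (hp : Function.Surjective p) : Function.Injective (ExtScalars.map f σ) := by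
  have : Projective (ModuleCat.of A P) := (IsProjective.iff_projective P).1 inferInstance
  have : Projective (ModuleCat.of A Q) := (IsProjective.iff_projective Q).1 inferInstance
  exact (ModuleCat.mono_iff_injective _).1 (mono_map_of_isZero_leftDerived_one
    (extFunctor.{u, u, u} f) (shortExact_shortComplexOfCompEqZero hσ he hp) hU)

theorem projective_of_shortExact (hU : HasProjectiveDimensionLE U 1) [Module.Projective A Q]
    (hσ : Function.Injective σ) (he : Function.Exact σ p) (hp : Function.Surjective p) :
    Module.Projective A P := by
  have hQ : Projective (ModuleCat.of A Q) := (IsProjective.iff_projective Q).1 inferInstance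
  have hP := ((shortExact_shortComplexOfCompEqZero hσ he hp).hasProjectiveDimensionLT_X₃_iff
    0 hQ).1 hU
  exact (IsProjective.iff_projective P).2 (projective_iff_hasProjectiveDimensionLT_one.2 hP)

theorem isFPOfProjDimLEOne_of_projective (U : ModuleCat.{u} A) [Module.Finite A U]
    [Module.Projective A U] : IsFPOfProjDimLEOne U := by
  have : Projective U := (IsProjective.iff_projective U).1 inferInstance
  have : HasProjectiveDimensionLT U 1 := projective_iff_hasProjectiveDimensionLT_one.1 this
  exact ⟨Module.finitePresentation_of_projective A U,
    hasProjectiveDimensionLT_of_ge U 1 2 one_le_two⟩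

theorem IsFPOfProjDimLEOne.exists_resolves (hU : IsFPOfProjDimLEOne U) :
    ∃ σ : ProjMap A, σ.Resolves U := by
  obtain ⟨_, hpd⟩ := hU
  obtain ⟨n, _, p, -, hp, -⟩ := Module.FinitePresentation.exists_fin' A U
  have hker : Function.Exact p.ker.subtype p := LinearMap.exact_subtype_ker_map p
  let σ : ProjMap A :=
    { P := ModuleCat.of A p.ker
      Q := ModuleCat.of A (Fin n → A)
      finite_P := Module.Finite.iff_fg.2 (Module.FinitePresentation.fg_ker p hp)
      finite_Q := inferInstanceAs (Module.Finite A (Fin n → A))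
      projective_P := projective_of_shortExact hpd p.ker.injective_subtype hker hp
      projective_Q := inferInstanceAs (Module.Projective A (Fin n → A))
      hom := p.ker.subtype }
  exact ⟨σ, p.ker.injective_subtype, p, hker, hp⟩

theorem IsRingEpi.isUniversalLocalisation_singleton (hf : IsRingEpi f) {σ : ProjMap A}
    (hσ : Function.Bijective (ExtScalars.map f σ.hom))
    (hext : ∀ (C : Type w) [Ring C] (g : A →+* C), Function.Bijective (ExtScalars.map g σ.hom) →
      ∃ h : B →+* C, g = h.comp f) :
    IsUniversalLocalisation.{u, w} f {σ} := by
  refine ⟨by rintro _ rfl; exact hσ, fun C _ g hg => ?_⟩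
  obtain ⟨h, rfl⟩ := hext C g (hg σ rfl)
  exact ⟨h, rfl, fun h' hh' => hf.ringHom_ext hh'.symm⟩

theorem SameEpiclassAsLocalisationAt.of_isUniversalLocalisation (hf : IsRingEpi f)
    (hU : IsFPOfProjDimLEOne U)
    (h : ∀ σ : ProjMap A, σ.Resolves U → IsUniversalLocalisation.{u, w} f {σ}) :
    SameEpiclassAsLocalisationAt.{u, w} f {U} := by
  refine ⟨B, inferInstance, f, ⟨?_, fun s hs => ?_⟩, hf, hf, RingEquiv.refl B, rfl⟩
  · rintro _ rfl
    exact ⟨hU, hU.exists_resolves⟩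
  · rw [Set.range_unique]
    exact h _ (hs _)

end ProjectiveDimension

section Pullback

variable {A : Type u} [Ring A]
variable {P Q M N L : Type v} [AddCommGroup P] [Module A P] [AddCommGroup Q] [Module A Q]
  [AddCommGroup M] [Module A M] [AddCommGroup N] [Module A N] [AddCommGroup L] [Module A L]
  {i : M →ₗ[A] N} {π : N →ₗ[A] L} {σ : P →ₗ[A] Q} {p : Q →ₗ[A] L}

/-- The exact sequence `P → Q ⊕ M → N → 0` is obtained by lifting `p` along `π` to `q`. -/
theorem exists_exact_prod_coprod (hi : Function.Injective i) (hiπ : Function.Exact i π)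
    (hπ : Function.Surjective π) [Module.Projective A Q] (he : Function.Exact σ p)
    (hp : Function.Surjective p) :
    ∃ (q : Q →ₗ[A] N) (α : P →ₗ[A] M), i ∘ₗ α = q ∘ₗ σ ∧
      Function.Exact (σ.prod α) (q.coprod (-i)) ∧ Function.Surjective (q.coprod (-i)) := by
  obtain ⟨q, rfl⟩ := Module.projective_lifting_property π p hπ
  have hmem : ∀ y, (q ∘ₗ σ) y ∈ LinearMap.range i := fun y =>
    (hiπ _).1 (he.apply_apply_eq_zero y)
  let e := LinearEquiv.ofInjective i hi
  let α := e.symm.toLinearMap ∘ₗ (q ∘ₗ σ).codRestrict (LinearMap.range i) hmem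
  have hα : ∀ y, i (α y) = q (σ y) := fun y =>
    congrArg Subtype.val (e.apply_symm_apply ⟨q (σ y), hmem y⟩)
  refine ⟨q, α, LinearMap.ext hα, fun ⟨x, m⟩ => ⟨fun hx => ?_, ?_⟩, fun n => ?_⟩
  · have hqx : q x = i m := by simpa [add_neg_eq_zero] using hx
    have hpx : π (q x) = 0 := hqx ▸ hiπ.apply_apply_eq_zero m
    obtain ⟨y, rfl⟩ := (he x).1 hpx
    exact ⟨y, Prod.ext rfl (hi ((hα y).trans hqx))⟩
  · rintro ⟨y, hy⟩
    simp [← hy, hα]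
  · obtain ⟨x, hx⟩ := hp (π n)
    obtain ⟨m, hm⟩ := (hiπ (q x - n)).1 ((map_sub π _ _).trans (sub_eq_zero.2 hx))
    exact ⟨(x, m), by simp [hm]⟩

theorem exists_semilinear_extension (hi : Function.Injective i) (hiπ : Function.Exact i π)
    (hπ : Function.Surjective π) [Module.Projective A Q] (he : Function.Exact σ p)
    (hp : Function.Surjective p) {C : Type w} [Ring C] {g : A →+* C}
    (hg : Function.Bijective (ExtScalars.map g σ)) {X : Type*} [AddCommGroup X] [Module C X]
    (ψ : M →ₛₗ[g] X) : ∃ φ : N →ₛₗ[g] X, ∀ m, φ (i m) = ψ m := by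
  obtain ⟨q, α, -, hexact, hsurj⟩ := exists_exact_prod_coprod hi hiπ hπ he hp
  obtain ⟨θ, hθ⟩ := ExtScalars.exists_semilinear_extension_of_bijective hg (ψ.comp α)
  let χ : Q × M →ₛₗ[g] X :=
    θ.comp (LinearMap.fst A Q M) - ψ.comp (LinearMap.snd A Q M)
  obtain ⟨φ, hφ⟩ := exists_semilinear_factor hsurj χ fun x hx => by
    obtain ⟨y, rfl⟩ := (hexact x).1 hx
    exact sub_eq_zero.2 (hθ y)
  refine ⟨φ, fun m => ?_⟩
  simpa [χ] using hφ (0, -m)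

end Pullback

section Injective

variable {A B : Type u} [Ring A] [Ring B] {f : A →+* B}

theorem map_injective_of_map_injective_of_isZero_tor {P Q M L : Type u} [AddCommGroup P]
    [Module A P] [AddCommGroup Q] [Module A Q] [AddCommGroup M] [Module A M] [AddCommGroup L]
    [Module A L] {N : ModuleCat.{u} A} {i : M →ₗ[A] N} {π : N →ₗ[A] L} {σ : P →ₗ[A] Q}
    {p : Q →ₗ[A] L} (hi : Function.Injective i) (hiπ : Function.Exact i π)
    (hπ : Function.Surjective π) [Module.Projective A P] [Module.Projective A Q]
    [Module.Projective A M] (hσ : Function.Injective σ) (he : Function.Exact σ p)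
    (hp : Function.Surjective p) (hN : Limits.IsZero (Tor f 1 N))
    (hfi : Function.Injective (ExtScalars.map f i)) :
    Function.Injective (ExtScalars.map f σ) := by
  obtain ⟨q, α, hq, hexact, hsurj⟩ := exists_exact_prod_coprod hi hiπ hπ he hp
  have hprod : Function.Injective (ExtScalars.map f (σ.prod α)) :=
    map_injective_of_isZero_tor hN (fun y z h => hσ (congrArg Prod.fst h)) hexact hsurj
  refine (injective_iff_map_eq_zero _).2 fun z hz => (injective_iff_map_eq_zero _).1 hprod z ?_
  have hα : ExtScalars.map f α z = 0 := (injective_iff_map_eq_zero _).1 hfi _ <| by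
    rw [← ExtScalars.map_comp_apply, hq, ExtScalars.map_comp_apply, hz, map_zero]
  rw [ExtScalars.map_prod_apply, hz, hα, map_zero, map_zero, add_zero]

theorem exact_asLinearMap_mkQ :
    Function.Exact (asLinearMap f) (LinearMap.range (asLinearMap f)).mkQ :=
  LinearMap.exact_map_mkQ_range _

theorem isFPOfProjDimLEOne_coker (hB : IsFPOfProjDimLEOne (asModule f))
    (hinj : Function.Injective f) : IsFPOfProjDimLEOne (coker f) := by
  obtain ⟨_, hpd⟩ := hB
  constructor
  · refine Module.finitePresentation_of_surjective (LinearMap.range (asLinearMap f)).mkQ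
      (Submodule.mkQ_surjective _) ?_
    rw [Submodule.ker_mkQ]
    exact Submodule.fg_range _
  · have : Projective (ModuleCat.of A A) := (IsProjective.iff_projective A).1 inferInstance
    have hA : HasProjectiveDimensionLT (ModuleCat.of A A) 1 :=
      projective_iff_hasProjectiveDimensionLT_one.1 this
    exact (shortExact_shortComplexOfCompEqZero (U := coker f) hinj exact_asLinearMap_mkQ
      (Submodule.mkQ_surjective _)).hasProjectiveDimensionLT_X₃ 1 hA hpd

theorem IsRingEpi.map_resolution_coker_bijective (hf : IsRingEpi f)
    (hTor : Limits.IsZero (Tor f 1 (asModule f))) (hinj : Function.Injective f) {σ : ProjMap A}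
    (hσ : σ.Resolves (coker f)) : Function.Bijective (ExtScalars.map f σ.hom) := by
  obtain ⟨hσinj, p, he, hp⟩ := hσ
  have := σ.projective_P
  have := σ.projective_Q
  have hmkQ := Submodule.mkQ_surjective (LinearMap.range (asLinearMap f))
  have hcoker : Subsingleton (ExtScalars f (coker f)) :=
    (ExtScalars.map_surjective_iff_subsingleton exact_asLinearMap_mkQ hmkQ).1
      hf.map_asLinearMap_bijective.2
  exact ⟨map_injective_of_map_injective_of_isZero_tor hinj exact_asLinearMap_mkQ hmkQ hσinj he hp
      hTor hf.map_asLinearMap_bijective.1,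
    (ExtScalars.map_surjective_iff_subsingleton he hp).2 hcoker⟩

/-- Right multiplication by an element of `B`, as an endomorphism of the left `A`-module `B`. -/
def rightMul (f : A →+* B) (b : B) : asModule f →ₗ[A] asModule f where
  toFun x := toAsModule f ((toAsModule f).symm x * b)
  map_add' x y := add_mul ((toAsModule f).symm x) ((toAsModule f).symm y) b
  map_smul' a x := mul_assoc (f a) ((toAsModule f).symm x) b

/-- Multiplicativity comes from uniqueness: `x ↦ φ (x b)` and `x ↦ φ x * φ b` are semilinear and
agree on `A`. -/
theorem exists_ringHom_extension {C : Type w} [Ring C] {g : A →+* C}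
    [Subsingleton (ExtScalars g (coker f))] (φ : asModule f →ₛₗ[g] C)
    (hφ : ∀ a, φ (asLinearMap f a) = g a) : ∃ h : B →+* C, g = h.comp f := by
  have hmul (b : B) : φ.comp (rightMul f b) =
      (LinearMap.toSpanSingleton C C (φ (toAsModule f b))).comp φ := by
    refine ExtScalars.semilinear_ext_of_exact exact_asLinearMap_mkQ
      (Submodule.mkQ_surjective (LinearMap.range (asLinearMap f))) fun a => ?_
    calc φ (a • toAsModule f b) = g a * φ (toAsModule f b) := φ.map_smulₛₗ a _
      _ = φ (asLinearMap f a) * φ (toAsModule f b) := by rw [hφ]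
  have hone : φ (toAsModule f 1) = 1 := by
    rw [← map_one f, ← asLinearMap_apply, hφ, map_one]
  let h : B →+* C :=
    { φ.toAddMonoidHom.comp (toAsModule f).toAddMonoidHom with
      map_one' := hone
      map_mul' := fun b c => LinearMap.congr_fun (hmul c) (toAsModule f b) }
  exact ⟨h, RingHom.ext fun a => (hφ a).symm⟩

theorem exists_ringHom_extension_of_resolves_coker (hinj : Function.Injective f) {σ : ProjMap A}
    (hσ : σ.Resolves (coker f)) {C : Type w} [Ring C] {g : A →+* C}
    (hg : Function.Bijective (ExtScalars.map g σ.hom)) : ∃ h : B →+* C, g = h.comp f := by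
  obtain ⟨-, p, he, hp⟩ := hσ
  have := σ.projective_Q
  have := (ExtScalars.map_surjective_iff_subsingleton he hp).1 hg.2
  let ψ : A →ₛₗ[g] C := { toFun := g, map_add' := map_add g, map_smul' := map_mul g }
  obtain ⟨φ, hφ⟩ := exists_semilinear_extension hinj exact_asLinearMap_mkQ
    (Submodule.mkQ_surjective _) he hp hg ψ
  exact exists_ringHom_extension φ hφ

theorem IsRingEpi.isUniversalLocalisation_coker (hf : IsRingEpi f)
    (hTor : Limits.IsZero (Tor f 1 (asModule f))) (hinj : Function.Injective f) {σ : ProjMap A}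
    (hσ : σ.Resolves (coker f)) : IsUniversalLocalisation.{u, w} f {σ} :=
  hf.isUniversalLocalisation_singleton (hf.map_resolution_coker_bijective hTor hinj hσ)
    fun _ _ _ hg => exists_ringHom_extension_of_resolves_coker hinj hσ hg

end Injective

section Surjective

variable {A B : Type u} [Ring A] [Ring B] {f : A →+* B}

theorem exact_subtype_ker_asLinearMap :
    Function.Exact (Submodule.subtype (RingHom.ker f)) (asLinearMap f) := fun a =>
  ⟨fun ha => ⟨⟨a, ha⟩, rfl⟩, by rintro ⟨x, rfl⟩; exact x.2⟩

theorem finite_projective_ker (hB : IsFPOfProjDimLEOne (asModule f))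
    (hsurj : Function.Surjective f) : Module.Finite A (ker f) ∧ Module.Projective A (ker f) := by
  obtain ⟨_, hpd⟩ := hB
  exact ⟨Module.Finite.iff_fg.2 (Module.FinitePresentation.fg_ker (asLinearMap f) hsurj),
    projective_of_shortExact hpd (Submodule.injective_subtype (RingHom.ker f))
      exact_subtype_ker_asLinearMap hsurj⟩

theorem subsingleton_extScalars_ker (hTor : Limits.IsZero (Tor f 1 (asModule f)))
    (hsurj : Function.Surjective f) [Module.Projective A (ker f)] :
    Subsingleton (ExtScalars f (ker f)) := by
  let ι : ker f →ₗ[A] A := Submodule.subtype (RingHom.ker f)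
  have hι : Function.Injective (ExtScalars.map f ι) :=
    map_injective_of_isZero_tor hTor (Submodule.injective_subtype (RingHom.ker f))
      exact_subtype_ker_asLinearMap hsurj
  have hzero : ExtScalars.map f ι = 0 := ExtScalars.map_eq_zero fun x => by
    have hx : f (ι x) = 0 := x.2
    rw [← mul_one (ι x), ← smul_eq_mul, LinearMap.map_smulₛₗ, hx, zero_smul]
  exact subsingleton_of_forall_eq 0 fun z => hι (by rw [hzero]; rfl)

theorem ker_le_ker_of_subsingleton {C : Type w} [Ring C] (g : A →+* C)
    [Subsingleton (ExtScalars g (ker f))] : RingHom.ker f ≤ RingHom.ker g := fun x hx => by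
  let γ : ker f →ₛₗ[g] C :=
    { toFun := fun y => g y.1
      map_add' := fun y z => map_add g y.1 z.1
      map_smul' := fun a y => map_mul g a y.1 }
  exact LinearMap.congr_fun (ExtScalars.semilinear_eq_zero γ) ⟨x, hx⟩

theorem exists_ringHom_extension_of_resolves_ker (hsurj : Function.Surjective f) {σ : ProjMap A}
    (hσ : σ.Resolves (ker f)) {C : Type w} [Ring C] {g : A →+* C}
    (hg : Function.Surjective (ExtScalars.map g σ.hom)) : ∃ h : B →+* C, g = h.comp f := by
  obtain ⟨-, p, he, hp⟩ := hσ
  have := (ExtScalars.map_surjective_iff_subsingleton he hp).1 hg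
  let g' : {g : A →+* C // RingHom.ker f ≤ RingHom.ker g} := ⟨g, ker_le_ker_of_subsingleton g⟩
  exact ⟨f.liftOfSurjective hsurj g', (RingHom.liftOfRightInverse_comp f _ _ g').symm⟩

theorem map_resolution_bijective {U : ModuleCat.{u} A} [Module.Projective A U]
    [Subsingleton (ExtScalars f U)] {σ : ProjMap A} (hσ : σ.Resolves U) :
    Function.Bijective (ExtScalars.map f σ.hom) := by
  obtain ⟨hinj, p, he, hp⟩ := hσ
  obtain ⟨s, hs⟩ := Module.projective_lifting_property p LinearMap.id hp
  have hsplit : (∃ s, p ∘ₗ s = LinearMap.id) ↔ ∃ r, r ∘ₗ σ.hom = LinearMap.id :=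
    (he.split_tfae hinj hp).out 0 1
  obtain ⟨r, hr⟩ := hsplit.1 ⟨s, hs⟩
  exact ⟨ExtScalars.map_injective_of_comp_eq_id hr,
    (ExtScalars.map_surjective_iff_subsingleton he hp).2 inferInstance⟩

theorem isUniversalLocalisation_ker (hsurj : Function.Surjective f)
    [Module.Projective A (ker f)] [Subsingleton (ExtScalars f (ker f))] {σ : ProjMap A}
    (hσ : σ.Resolves (ker f)) : IsUniversalLocalisation.{u, w} f {σ} :=
  (isRingEpi_of_surjective hsurj).isUniversalLocalisation_singleton (map_resolution_bijective hσ)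
    fun _ _ _ hg => exists_ringHom_extension_of_resolves_ker hsurj hσ hg.2

/-- With `I = ker f`, a dual basis of `I` writes `x ∈ I` as a sum of elements `s x i * i`; the
coordinates `s x i` lie in `I`, because the map `x ↦ f (s x i)` factors through `B ⊗_A I = 0`. -/
theorem isIdempotentElem_ker [Module.Projective A (ker f)]
    [Subsingleton (ExtScalars f (ker f))] : IsIdempotentElem (RingHom.ker f) := by
  refine le_antisymm Ideal.mul_le_left fun x hx => ?_
  obtain ⟨s, hs⟩ := (inferInstance : Module.Projective A (ker f)).out
  have hmem (y i : ker f) : s y i ∈ RingHom.ker f := by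
    let γ : ker f →ₛₗ[f] B :=
      { toFun := fun z => f (s z i)
        map_add' := fun z t => by simp
        map_smul' := fun a z => by simp }
    exact LinearMap.congr_fun (ExtScalars.semilinear_eq_zero γ) y
  have hsum : x = ∑ i ∈ (s ⟨x, hx⟩).support, s ⟨x, hx⟩ i * i.1 := by
    have := congrArg (Submodule.subtype (RingHom.ker f)) (hs ⟨x, hx⟩)
    rw [Finsupp.linearCombination_apply, Finsupp.sum, map_sum] at this
    exact this.symm
  rw [hsum]
  exact Submodule.sum_mem _ fun i _ => Ideal.mul_mem_mul (hmem _ i) i.2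

end Surjective

section Semiperfect

variable {A : Type*} [Ring A]

/-- A ring is semiperfect if it is semisimple modulo its Jacobson radical and idempotents lift
modulo the Jacobson radical. Idempotent two-sided ideals that are finitely generated as left ideals
are then generated by idempotents. -/
class IsSemiperfectRing (A : Type*) [Ring A] : Prop where
  isSemisimpleRing : IsSemisimpleRing (A ⧸ Ring.jacobson A)
  exists_lift (e : A ⧸ Ring.jacobson A) : IsIdempotentElem e →
    ∃ e' : A, IsIdempotentElem e' ∧ Ideal.Quotient.mk (Ring.jacobson A) e' = e

attribute [instance] IsSemiperfectRing.isSemisimpleRing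

instance [IsSemiprimaryRing A] : IsSemiperfectRing A where
  isSemisimpleRing := inferInstance
  exists_lift e he := by
    obtain ⟨n, hn⟩ := IsSemiprimaryRing.isNilpotent (R := A)
    have hnil : ∀ x ∈ RingHom.ker (Ideal.Quotient.mk (Ring.jacobson A)), IsNilpotent x :=
      fun x hx => ⟨n, by
        have := Ideal.pow_mem_pow (Ideal.mk_ker.le hx) n
        rwa [hn] at this⟩
    exact exists_isIdempotentElem_eq_of_ker_isNilpotent _ hnil e
      (Ideal.Quotient.mk_surjective e) he

theorem eq_zero_of_isIdempotentElem_of_mem_jacobson {e : A} (he : IsIdempotentElem e)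
    (hmem : e ∈ Ring.jacobson A) : e = 0 := by
  have hbot : Ideal.span {e} = ⊥ :=
    (Submodule.fg_span_singleton e).eq_bot_of_le_jacobson_smul <|
      (Ideal.span_singleton_le_iff_mem _).2 <| by
        simpa only [smul_eq_mul, he.eq] using
          Submodule.smul_mem_smul hmem (Ideal.mem_span_singleton_self e)
  exact Ideal.span_singleton_eq_bot.1 hbot

/-- Any idempotent lift `e` of a generator of the image of `I` in `A ⧸ Ring.jacobson A` lies in `I`:
its image in `A ⧸ I` is an idempotent of the Jacobson radical. -/
theorem exists_isIdempotentElem_mem_le_span_sup_jacobson [IsSemiperfectRing A] (I : Ideal A)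
    [I.IsTwoSided] :
    ∃ e ∈ I, IsIdempotentElem e ∧ I ≤ Ring.jacobson A ⊔ Ideal.span {e} := by
  obtain ⟨_, hidem, hspan⟩ :=
    IsSemisimpleRing.ideal_eq_span_idempotent (I.map (Ideal.Quotient.mk (Ring.jacobson A)))
  obtain ⟨e, he, rfl⟩ := IsSemiperfectRing.exists_lift _ hidem
  have hsup : Ring.jacobson A ⊔ I = Ring.jacobson A ⊔ Ideal.span {e} := by
    rw [← Ideal.comap_map_quotientMk, hspan, ← Set.image_singleton, ← Ideal.map_span,
      Ideal.comap_map_quotientMk]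
  refine ⟨e, ?_, he, hsup ▸ le_sup_right⟩
  obtain ⟨j, hj, x, hx, hjx⟩ := Submodule.mem_sup.1
    (hsup.ge (Ideal.mem_sup_right (Ideal.mem_span_singleton_self e)))
  have hmem : Ideal.Quotient.mk I e ∈ Ring.jacobson (A ⧸ I) := by
    rw [← hjx, map_add, Ideal.Quotient.eq_zero_iff_mem.2 hx, add_zero]
    exact Ring.le_comap_jacobson (Ideal.Quotient.mk I) hj
  exact Ideal.Quotient.eq_zero_iff_mem.1
    (eq_zero_of_isIdempotentElem_of_mem_jacobson (he.map _) hmem)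

theorem le_of_fg_of_le_sup_jacobson_smul {M : Type*} [AddCommGroup M] [Module A M]
    {N K : Submodule A M} (hfg : N.FG) (hle : N ≤ K ⊔ Ring.jacobson A • N) : N ≤ K := by
  have hbot : N.map K.mkQ = ⊥ := (hfg.map K.mkQ).eq_bot_of_le_jacobson_smul <|
    calc N.map K.mkQ ≤ (K ⊔ Ring.jacobson A • N).map K.mkQ := Submodule.map_mono hle
      _ = Ring.jacobson A • N.map K.mkQ := by
        rw [Submodule.map_sup, Submodule.mkQ_map_self, bot_sup_eq, Submodule.map_smul'']
  rwa [← LinearMap.le_ker_iff_map, Submodule.ker_mkQ] at hbot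

theorem exists_isIdempotentElem_span_eq [IsSemiperfectRing A] {I : Ideal A} [I.IsTwoSided]
    (hfg : I.FG) (hI : IsIdempotentElem I) :
    ∃ e, IsIdempotentElem e ∧ (TwoSidedIdeal.span {e}).asIdeal = I := by
  obtain ⟨e, heI, he, hle⟩ := exists_isIdempotentElem_mem_le_span_sup_jacobson I
  let K : Ideal A := (TwoSidedIdeal.span {e}).asIdeal
  have heK : Ideal.span {e} ≤ K := (Ideal.span_singleton_le_iff_mem K).2 <|
    TwoSidedIdeal.mem_asIdeal.2 (TwoSidedIdeal.subset_span rfl)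
  have hKI : K ≤ I := by
    rw [← I.asIdeal_toTwoSided]
    exact TwoSidedIdeal.asIdeal.monotone <| TwoSidedIdeal.span_le.2 <|
      Set.singleton_subset_iff.2 (Ideal.mem_toTwoSided.2 heI)
  refine ⟨e, he, hKI.antisymm (le_of_fg_of_le_sup_jacobson_smul hfg ?_)⟩
  calc I = I * I := hI.eq.symm
    _ ≤ (Ring.jacobson A ⊔ K) * I := Ideal.mul_mono_left (hle.trans (sup_le_sup_left heK _))
    _ = K * I ⊔ Ring.jacobson A • I := by rw [Ideal.sup_mul, sup_comm, smul_eq_mul]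
    _ ≤ K ⊔ Ring.jacobson A • I := sup_le_sup_right Ideal.mul_le_left _

end Semiperfect

theorem SameEpiclass.of_surjective {A B C : Type u} [Ring A] [Ring B] [Ring C] {f : A →+* B}
    {g : A →+* C} (hf : Function.Surjective f) (hg : Function.Surjective g)
    (h : RingHom.ker f = RingHom.ker g) : SameEpiclass f g := by
  refine ⟨isRingEpi_of_surjective hf, isRingEpi_of_surjective hg,
    ((RingHom.quotientKerEquivOfSurjective hf).symm.trans (Ideal.quotEquivOfEq h)).trans
      (RingHom.quotientKerEquivOfSurjective hg), RingHom.ext fun x => ?_⟩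
  simp

theorem modIdeal_surjective {A : Type u} [Ring A] (e : A) : Function.Surjective (modIdeal e) :=
  RingCon.mk'_surjective _

theorem ker_modIdeal {A : Type u} [Ring A] (e : A) :
    RingHom.ker (modIdeal e) = (TwoSidedIdeal.span {e}).asIdeal := by
  ext x
  rw [TwoSidedIdeal.mem_asIdeal, RingHom.mem_ker, ← TwoSidedIdeal.mem_ker, modIdeal,
    TwoSidedIdeal.ker_ringCon_mk']

end RingEpi

end

theorem corollary3p5_general {A B : Type u} [Ring A] [Ring B] (f : A →+* B)
    (hf : RingEpi.IsHomological f) (hfin : RingEpi.IsOneFinite f) :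
    (Function.Injective f →
      RingEpi.IsFPOfProjDimLEOne (RingEpi.coker f) ∧
      RingEpi.SameEpiclassAsLocalisationAt.{u, w} f {RingEpi.coker f}) ∧
    (Function.Surjective f →
      (Module.FinitePresentation A (RingEpi.ker f) ∧ Module.Projective A (RingEpi.ker f)) ∧
      RingEpi.SameEpiclassAsLocalisationAt.{u, w} f {RingEpi.ker f}) ∧
    ([RingEpi.IsSemiperfectRing A] →
      Function.Surjective f →
      ∃ e : A, IsIdempotentElem e ∧ RingEpi.SameEpiclass f (RingEpi.modIdeal e)) := by
  obtain ⟨hepi, hTor⟩ := hf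
  have hTor₁ := hTor 1 one_pos
  refine ⟨fun hinj => ?_, fun hsurj => ?_, fun hsurj => ?_⟩
  · have hU := RingEpi.isFPOfProjDimLEOne_coker hfin.2 hinj
    exact ⟨hU, .of_isUniversalLocalisation hepi hU fun _ hσ =>
      hepi.isUniversalLocalisation_coker hTor₁ hinj hσ⟩
  · obtain ⟨_, hproj⟩ := RingEpi.finite_projective_ker hfin.2 hsurj
    have := RingEpi.subsingleton_extScalars_ker hTor₁ hsurj
    have hU := RingEpi.isFPOfProjDimLEOne_of_projective (RingEpi.ker f)
    exact ⟨⟨hU.1, hproj⟩, .of_isUniversalLocalisation hepi hU fun _ hσ =>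
      RingEpi.isUniversalLocalisation_ker hsurj hσ⟩
  · obtain ⟨hfinite, _⟩ := RingEpi.finite_projective_ker hfin.2 hsurj
    have := RingEpi.subsingleton_extScalars_ker hTor₁ hsurj
    obtain ⟨e, he, hspan⟩ := RingEpi.exists_isIdempotentElem_span_eq
      (Module.Finite.iff_fg.1 hfinite) RingEpi.isIdempotentElem_ker
    exact ⟨e, he, .of_surjective hsurj (RingEpi.modIdeal_surjective e)
      (hspan.symm.trans (RingEpi.ker_modIdeal e).symm)⟩

theorem corollary3p5 {A B : Type u} [Ring A] [Ring B] (f : A →+* B)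
    (hf : RingEpi.IsHomological f) (hfin : RingEpi.IsOneFinite f) :
    (Function.Injective f →
      RingEpi.IsFPOfProjDimLEOne (RingEpi.coker f) ∧
      RingEpi.SameEpiclassAsLocalisationAt.{u, w} f {RingEpi.coker f}) ∧
    (Function.Surjective f →
      (Module.FinitePresentation A (RingEpi.ker f) ∧ Module.Projective A (RingEpi.ker f)) ∧
      RingEpi.SameEpiclassAsLocalisationAt.{u, w} f {RingEpi.ker f}) ∧
    (∀ (K : Type v) [Field K] [Algebra K A] [FiniteDimensional K A],
      Function.Surjective f →
      ∃ e : A, IsIdempotentElem e ∧ RingEpi.SameEpiclass f (RingEpi.modIdeal e)) := by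
  obtain ⟨hinj, hsurj, hsemiperfect⟩ := corollary3p5_general.{u, w} f hf hfin
  refine ⟨hinj, hsurj, fun K _ _ _ => ?_⟩
  have : IsArtinianRing A := isArtinian_of_tower K inferInstance
  exact hsemiperfect
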